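/- Let $(N^n,g)$ be a smooth Riemannian manifold with an almost contact metric structure $(\xi,\eta,\varphi)$: $\xi$ is a smooth unit vector field, $\eta=g(\xi,\cdot)$, and $\varphi\colon TN\to TN$ is a smooth bundle endomorphism with $$\varphi(\xi)=0,\qquad \varphi^2=-1+\eta\otimes\xi,\qquad g(\varphi X,\varphi Y)=g(X,Y)-\eta(X)\eta(Y)$$ (so $n$ is odd). Write $d\eta(X,Y)=X\eta(Y)-Y\eta(X)-\eta([X,Y])$, $F=g(\varphi\,\cdot,\cdot)$, $d^\varphi F(X,Y,Z)=dF(\varphi X,\varphi Y,\varphi Z)$, and let $$c=\eta\wedge d\eta+d^\varphi F,\qquad (\eta\wedge d\eta)(X,Y,Z)=\eta(X)d\eta(Y,Z)+\eta(Y)d\eta(Z,X)+\eta(Z)d\eta(X,Y).$$ Assume that the structure is normal, i.e. for all vector fields $X,Y$ $$[\varphi X,\varphi Y]+\varphi^2[X,Y]-\varphi[\varphi X,Y]-\varphi[X,\varphi Y]+d\eta(X,Y)\,\xi=0.$$ Call $N$ an ST manifold (Sasaki with torsion) if, in addition, $\xi$ is a Killing vector field, $\mathcal L_\xi g=0$.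 Call a smooth connection $D$ on $TN$ an almost contact metric connection if $Dg=0$, $D\xi=0$ and $D\varphi=0$. Let $\nabla^{LC}$ be the Levi-Civita connection and define the connection $\nabla$ by $$g(\nabla_XY,Z)=g(\nabla^{LC}_XY,Z)+\tfrac12\,c(X,Y,Z).$$ **Proposition.** (1) $N$ is an ST manifold if and only if $\nabla$ is an almost contact metric connection. (2) $N$ is an ST manifold if and only if there is an almost contact metric connection $D$ on $N$ with skew torsion, i.e. such that $(X,Y,Z)\mapsto g(D_XY-D_YX-[X,Y],Z)$ is totally skew-symmetric. -/

import Mathlib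

open Bundle VectorField FiberBundle
open scoped Manifold ContDiff

namespace SasakiTorsion


noncomputable section

variable {E : Type*} [NormedAddCommGroup E] [NormedSpace ℝ E] [FiniteDimensional ℝ E]
  [CompleteSpace E]
  {H : Type*} [TopologicalSpace H] {I : ModelWithCorners ℝ E H}
  {M : Type*} [TopologicalSpace M] [ChartedSpace H M] [IsManifold I ∞ M]
  [RiemannianBundle (fun x : M ↦ TangentSpace I x)]
  [IsContMDiffRiemannianBundle I ∞ E (fun x : M ↦ TangentSpace I x)]

/-- The Koszul expression, which is `2 g(∇_X Y, Z)` for the Levi-Civita connection `∇`. -/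
def koszul (X Y Z : Π x : M, TangentSpace I x) (x : M) : ℝ :=
  d% (fun y ↦ inner ℝ (Y y) (Z y)) x (X x) + d% (fun y ↦ inner ℝ (X y) (Z y)) x (Y x)
    - d% (fun y ↦ inner ℝ (X y) (Y y)) x (Z x)
    + inner ℝ (mlieBracket I X Y x) (Z x) - inner ℝ (mlieBracket I X Z x) (Y x)
    - inner ℝ (mlieBracket I Y Z x) (X x)

theorem mdifferentiableAt_inner {x : M} {X Y : Π x : M, TangentSpace I x}
    (hX : MDiffAt (T% X) x) (hY : MDiffAt (T% Y) x) :
    MDiffAt (fun y ↦ inner ℝ (X y) (Y y)) x :=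
  MDifferentiableAt.inner_bundle (E := fun x : M ↦ TangentSpace I x) (b := id) hX hY

theorem koszul_tensorial_left {x : M} {Y Z : Π x : M, TangentSpace I x}
    (hY : MDiffAt (T% Y) x) (hZ : MDiffAt (T% Z) x) :
    TensorialAt I E (fun X ↦ koszul X Y Z x) x where
  smul {f X} hf hX := by
    simp only [koszul, mlieBracket_smul_left hf hX, Pi.smul_apply', inner_add_left,
      real_inner_smul_left]
    rw [mvfderiv_fun_mul hf (mdifferentiableAt_inner hX hZ),
      mvfderiv_fun_mul hf (mdifferentiableAt_inner hX hY)]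
    simp [real_inner_smul_right]
    ring
  add {X X'} hX hX' := by
    simp only [koszul, mlieBracket_add_left hX hX', Pi.add_apply, inner_add_left, inner_add_right]
    rw [mvfderiv_fun_add (mdifferentiableAt_inner hX hZ) (mdifferentiableAt_inner hX' hZ),
      mvfderiv_fun_add (mdifferentiableAt_inner hX hY) (mdifferentiableAt_inner hX' hY)]
    simp
    ring

theorem koszul_tensorial_right {x : M} {X Y : Π x : M, TangentSpace I x}
    (hX : MDiffAt (T% X) x) (hY : MDiffAt (T% Y) x) :
    TensorialAt I E (fun Z ↦ koszul X Y Z x) x where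
  smul {f Z} hf hZ := by
    simp only [koszul, mlieBracket_smul_right hf hZ, Pi.smul_apply', inner_add_left,
      real_inner_smul_left, real_inner_smul_right]
    rw [mvfderiv_fun_mul hf (mdifferentiableAt_inner hY hZ),
      mvfderiv_fun_mul hf (mdifferentiableAt_inner hX hZ)]
    simp [real_inner_comm]
    ring
  add {Z Z'} hZ hZ' := by
    simp only [koszul, mlieBracket_add_right hZ hZ', Pi.add_apply, inner_add_left, inner_add_right]
    rw [mvfderiv_fun_add (mdifferentiableAt_inner hY hZ) (mdifferentiableAt_inner hY hZ'),
      mvfderiv_fun_add (mdifferentiableAt_inner hX hZ) (mdifferentiableAt_inner hX hZ')]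
    simp
    ring

theorem koszul_add_mid {x : M} {X Y Y' Z : Π x : M, TangentSpace I x}
    (hX : MDiffAt (T% X) x) (hY : MDiffAt (T% Y) x) (hY' : MDiffAt (T% Y') x)
    (hZ : MDiffAt (T% Z) x) :
    koszul X (Y + Y') Z x = koszul X Y Z x + koszul X Y' Z x := by
  simp only [koszul, mlieBracket_add_right hY hY', mlieBracket_add_left hY hY', Pi.add_apply,
    inner_add_left, inner_add_right]
  rw [mvfderiv_fun_add (mdifferentiableAt_inner hY hZ) (mdifferentiableAt_inner hY' hZ),
    mvfderiv_fun_add (mdifferentiableAt_inner hX hY) (mdifferentiableAt_inner hX hY')]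
  simp
  ring

theorem koszul_smul_mid {x : M} {f : M → ℝ} {X Y Z : Π x : M, TangentSpace I x}
    (hf : MDiffAt f x) (hX : MDiffAt (T% X) x) (hY : MDiffAt (T% Y) x) (hZ : MDiffAt (T% Z) x) :
    koszul X (f • Y) Z x = f x * koszul X Y Z x + 2 * (d% f x (X x)) * inner ℝ (Y x) (Z x) := by
  simp only [koszul, mlieBracket_smul_right hf hY, mlieBracket_smul_left hf hY, Pi.smul_apply',
    inner_add_left, real_inner_smul_left, real_inner_smul_right]
  rw [mvfderiv_fun_mul hf (mdifferentiableAt_inner hY hZ),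
    mvfderiv_fun_mul hf (mdifferentiableAt_inner hX hY)]
  simp [real_inner_comm]
  ring

instance finiteDimensional_tangentSpace (x : M) : FiniteDimensional ℝ (TangentSpace I x) :=
  inferInstanceAs (FiniteDimensional ℝ E)

instance completeSpace_tangentSpace (x : M) : CompleteSpace (TangentSpace I x) :=
  FiniteDimensional.complete ℝ (TangentSpace I x)

/-- The vector representing a linear form on a tangent space through the metric. -/
def sharp (x : M) : (TangentSpace I x →L[ℝ] ℝ) →L[ℝ] TangentSpace I x :=
  LinearMap.toContinuousLinearMap
    { toFun := fun α ↦ (InnerProductSpace.toDual ℝ (TangentSpace I x)).symm α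
      map_add' := fun α β ↦ map_add _ α β
      map_smul' := fun c α ↦ by simp }

theorem inner_sharp (x : M) (α : TangentSpace I x →L[ℝ] ℝ) (v : TangentSpace I x) :
    inner ℝ (sharp x α) v = α v :=
  InnerProductSpace.toDual_symm_apply (𝕜 := ℝ) (E := TangentSpace I x)

open Classical in
/-- The Levi-Civita derivative `u ↦ ∇_u Y` at `x`; on a field that is not differentiable at `x` it
is zero. -/
def leviCivitaFun (Y : Π x : M, TangentSpace I x) (x : M) :
    TangentSpace I x →L[ℝ] TangentSpace I x :=
  if hY : MDiffAt (T% Y) x then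
    (2⁻¹ : ℝ) • (sharp x ∘L TensorialAt.mkHom₂ (fun X Z ↦ koszul X Y Z x) x
      (fun _ hZ ↦ koszul_tensorial_left hY hZ) (fun _ hX ↦ koszul_tensorial_right hX hY))
  else 0

theorem inner_leviCivitaFun {x : M} {X Y Z : Π x : M, TangentSpace I x}
    (hX : MDiffAt (T% X) x) (hY : MDiffAt (T% Y) x) (hZ : MDiffAt (T% Z) x) :
    inner ℝ (leviCivitaFun Y x (X x)) (Z x) = koszul X Y Z x / 2 := by
  have := TensorialAt.mkHom₂_apply (Φ := fun X Z ↦ koszul X Y Z x) (x := x)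
      (fun _ hZ ↦ koszul_tensorial_left hY hZ) (fun _ hX ↦ koszul_tensorial_right hX hY) hX hZ
  simp [leviCivitaFun, hY, real_inner_smul_left, inner_sharp, this]
  ring

theorem ext_fields {x : M} {A B : TangentSpace I x →L[ℝ] TangentSpace I x}
    (h : ∀ X Z : Π x : M, TangentSpace I x, MDiffAt (T% X) x → MDiffAt (T% Z) x →
      inner ℝ (A (X x)) (Z x) = inner ℝ (B (X x)) (Z x)) : A = B := by
  ext u
  refine ext_inner_right ℝ fun v ↦ ?_
  simpa using h (extend E u) (extend E v) (mdifferentiableAt_extend ..)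
    (mdifferentiableAt_extend ..)

variable (I M) in
/-- The Levi-Civita connection. -/
def leviCivita : CovariantDerivative I E (fun x : M ↦ TangentSpace I x) where
  toFun := leviCivitaFun
  isCovariantDerivativeOnUniv :=
    { add := fun {Y Y' x} hY hY' _ ↦ by
        refine ext_fields fun X Z hX hZ ↦ ?_
        simp [inner_leviCivitaFun hX (mdifferentiableAt_add_section hY hY') hZ,
          inner_add_left, inner_leviCivitaFun hX hY hZ,
          inner_leviCivitaFun hX hY' hZ, koszul_add_mid hX hY hY' hZ]
        ring
      leibniz := fun {Y f x} hY hf _ ↦ by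
        refine ext_fields fun X Z hX hZ ↦ ?_
        simp [inner_leviCivitaFun hX (hf.smul_section hY) hZ, inner_leviCivitaFun hX hY hZ,
          inner_add_left, real_inner_smul_left, koszul_smul_mid hf hX hY hZ]
        ring }

theorem inner_leviCivita {x : M} {X Y Z : Π x : M, TangentSpace I x}
    (hX : MDiffAt (T% X) x) (hY : MDiffAt (T% Y) x) (hZ : MDiffAt (T% Z) x) :
    inner ℝ (leviCivita I M Y x (X x)) (Z x) = koszul X Y Z x / 2 :=
  inner_leviCivitaFun hX hY hZ

/-- The connection `D` preserves the metric: `X g(Y, Z) = g(D_X Y, Z) + g(Y, D_X Z)`. -/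
def PreservesMetric (D : CovariantDerivative I E (fun x : M ↦ TangentSpace I x)) : Prop :=
  ∀ (x : M) (X Y Z : Π y : M, TangentSpace I y),
    MDiffAt (T% X) x → MDiffAt (T% Y) x → MDiffAt (T% Z) x →
    d% (fun y ↦ inner ℝ (Y y) (Z y)) x (X x)
      = inner ℝ (D Y x (X x)) (Z x) + inner ℝ (Y x) (D Z x (X x))

theorem leviCivita_preservesMetric : PreservesMetric (leviCivita I M) := by
  intro x X Y Z hX hY hZ
  have h := inner_leviCivita hX hZ hY
  rw [real_inner_comm] at h
  rw [inner_leviCivita hX hY hZ, h]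
  have e1 : (fun y ↦ inner ℝ (Z y) (Y y)) = (fun y ↦ inner ℝ (Y y) (Z y)) := by
    ext y; exact real_inner_comm _ _
  simp only [koszul, mlieBracket_swap_apply (V := Z) (W := Y), e1]
  simp
  ring

theorem leviCivita_torsion : (leviCivita I M).torsion = 0 := by
  rw [CovariantDerivative.torsion_eq_zero_iff]
  intro X Y x hX hY
  refine ext_inner_right ℝ fun v ↦ ?_
  have hv : MDiffAt (T% (extend E v : Π y : M, TangentSpace I y)) x :=
    mdifferentiableAt_extend ..
  have h1 := inner_leviCivita hX hY hv
  have h2 := inner_leviCivita hY hX hv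
  simp only [extend_apply_self] at h1 h2
  have e1 : (fun y ↦ inner ℝ (Y y) (X y)) = (fun y ↦ inner ℝ (X y) (Y y)) := by
    ext y; exact real_inner_comm _ _
  rw [inner_sub_left, h1, h2]
  simp only [koszul, mlieBracket_swap_apply (V := Y) (W := X), e1]
  simp
  ring

/-! ### Exterior derivatives of forms, by the invariant formula -/

/-- The exterior derivative `dα(X, Y) = X α(Y) - Y α(X) - α([X, Y])` of a 1-form at `x`. -/
def extDerivOne (α : Π x : M, TangentSpace I x →L[ℝ] ℝ) (X Y : Π x : M, TangentSpace I x)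
    (x : M) : ℝ :=
  d% (fun y ↦ α y (Y y)) x (X x) - d% (fun y ↦ α y (X y)) x (Y x) - α x (mlieBracket I X Y x)

/-- The exterior derivative of a 2-form `β` at `x`: `dβ(X, Y, Z)` is the cyclic sum of
`X β(Y, Z) - β([X, Y], Z)`. -/
def extDerivTwo (β : Π x : M, TangentSpace I x →L[ℝ] TangentSpace I x →L[ℝ] ℝ)
    (X Y Z : Π x : M, TangentSpace I x) (x : M) : ℝ :=
  d% (fun y ↦ β y (Y y) (Z y)) x (X x) + d% (fun y ↦ β y (Z y) (X y)) x (Y x)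
    + d% (fun y ↦ β y (X y) (Y y)) x (Z x)
    - β x (mlieBracket I X Y x) (Z x) - β x (mlieBracket I Y Z x) (X x)
    - β x (mlieBracket I Z X x) (Y x)

theorem extDerivOne_tensorial {α : Π x : M, TangentSpace I x →L[ℝ] ℝ} {x : M}
    (hα : ∀ Y : Π x : M, TangentSpace I x, MDiffAt (T% Y) x → MDiffAt (fun y ↦ α y (Y y)) x)
    (Y : Π x : M, TangentSpace I x) :
    TensorialAt I E (fun X ↦ extDerivOne α X Y x) x where
  smul {f X} hf hX := by
    simp only [extDerivOne, mlieBracket_smul_left hf hX, Pi.smul_apply', map_add, map_smul,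
      smul_eq_mul]
    rw [mvfderiv_fun_mul hf (hα X hX)]
    simp
    ring
  add {X X'} hX hX' := by
    simp only [extDerivOne, mlieBracket_add_left hX hX', Pi.add_apply, map_add]
    rw [mvfderiv_fun_add (hα X hX) (hα X' hX')]
    simp
    ring

theorem extDerivOne_swap (α : Π x : M, TangentSpace I x →L[ℝ] ℝ)
    (X Y : Π x : M, TangentSpace I x) (x : M) :
    extDerivOne α X Y x = - extDerivOne α Y X x := by
  simp only [extDerivOne, mlieBracket_swap_apply (V := X) (W := Y), map_neg]
  ring

theorem extDerivTwo_cyclic (β : Π x : M, TangentSpace I x →L[ℝ] TangentSpace I x →L[ℝ] ℝ)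
    (X Y Z : Π x : M, TangentSpace I x) (x : M) :
    extDerivTwo β X Y Z x = extDerivTwo β Y Z X x := by
  simp only [extDerivTwo]
  ring

theorem extDerivTwo_tensorial
    {β : Π x : M, TangentSpace I x →L[ℝ] TangentSpace I x →L[ℝ] ℝ} {x : M}
    (hβ : ∀ Y Z : Π x : M, TangentSpace I x, MDiffAt (T% Y) x → MDiffAt (T% Z) x →
      MDiffAt (fun y ↦ β y (Y y) (Z y)) x) (hβ' : ∀ y u v, β y u v = - β y v u)
    {Y Z : Π x : M, TangentSpace I x} (hY : MDiffAt (T% Y) x) (hZ : MDiffAt (T% Z) x) :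
    TensorialAt I E (fun X ↦ extDerivTwo β X Y Z x) x where
  smul {f X} hf hX := by
    simp only [extDerivTwo, mlieBracket_smul_left hf hX, mlieBracket_smul_right hf hX,
      Pi.smul_apply', map_add, map_smul, smul_eq_mul, _root_.add_apply,
      _root_.smul_apply]
    rw [mvfderiv_fun_mul hf (hβ Z X hZ hX), mvfderiv_fun_mul hf (hβ X Y hX hY)]
    simp
    rw [hβ' x (Z x) (X x)]
    ring
  add {X X'} hX hX' := by
    simp only [extDerivTwo, mlieBracket_add_left hX hX', mlieBracket_add_right hX hX',
      Pi.add_apply, map_add, _root_.add_apply]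
    rw [mvfderiv_fun_add (hβ Z X hZ hX) (hβ Z X' hZ hX'),
      mvfderiv_fun_add (hβ X Y hX hY) (hβ X' Y hX' hY)]
    simp
    ring

set_option synthInstance.maxHeartbeats 400000 in
open Classical in
/-- The trilinear form on `T_x M` given by an operation that is tensorial in each argument. -/
def trilinearOfTensorial (Φ : (Π x : M, TangentSpace I x) → (Π x : M, TangentSpace I x) →
      (Π x : M, TangentSpace I x) → ℝ) (x : M)
    (h₁ : ∀ Y Z, MDiffAt (T% Y) x → MDiffAt (T% Z) x → TensorialAt I E (fun X ↦ Φ X Y Z) x)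
    (h₂ : ∀ X Z, MDiffAt (T% X) x → MDiffAt (T% Z) x → TensorialAt I E (fun Y ↦ Φ X Y Z) x)
    (h₃ : ∀ X Y, MDiffAt (T% X) x → MDiffAt (T% Y) x → TensorialAt I E (fun Z ↦ Φ X Y Z) x) :
    TangentSpace I x →L[ℝ] TangentSpace I x →L[ℝ] TangentSpace I x →L[ℝ] ℝ :=
  TensorialAt.mkHom (I := I) (F := E)
    (fun X ↦ if hX : MDiffAt (T% X) x then
      TensorialAt.mkHom₂ (Φ X) x (fun Z hZ ↦ h₂ X Z hX hZ) (fun Y hY ↦ h₃ X Y hX hY) else 0) x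
    { smul := fun {f X} hf hX ↦ by
        rw [dif_pos (hf.smul_section hX), dif_pos hX]
        ext v w
        exact (h₁ _ _ (mdifferentiableAt_extend ..) (mdifferentiableAt_extend ..)).smul hf hX
      add := fun {X X'} hX hX' ↦ by
        rw [dif_pos (mdifferentiableAt_add_section hX hX'), dif_pos hX, dif_pos hX']
        ext v w
        exact (h₁ _ _ (mdifferentiableAt_extend ..) (mdifferentiableAt_extend ..)).add hX hX' }

set_option synthInstance.maxHeartbeats 400000 in
theorem trilinearOfTensorial_apply {Φ : (Π x : M, TangentSpace I x) →
      (Π x : M, TangentSpace I x) → (Π x : M, TangentSpace I x) → ℝ} {x : M}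
    (h₁ : ∀ Y Z, MDiffAt (T% Y) x → MDiffAt (T% Z) x → TensorialAt I E (fun X ↦ Φ X Y Z) x)
    (h₂ : ∀ X Z, MDiffAt (T% X) x → MDiffAt (T% Z) x → TensorialAt I E (fun Y ↦ Φ X Y Z) x)
    (h₃ : ∀ X Y, MDiffAt (T% X) x → MDiffAt (T% Y) x → TensorialAt I E (fun Z ↦ Φ X Y Z) x)
    {X Y Z : Π x : M, TangentSpace I x}
    (hX : MDiffAt (T% X) x) (hY : MDiffAt (T% Y) x) (hZ : MDiffAt (T% Z) x) :
    trilinearOfTensorial Φ x h₁ h₂ h₃ (X x) (Y x) (Z x) = Φ X Y Z := by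
  unfold trilinearOfTensorial
  rw [TensorialAt.mkHom_apply _ hX, dif_pos hX]
  exact TensorialAt.mkHom₂_apply _ _ hY hZ

/-! ### Almost contact metric structures -/

variable (I M) in
/-- An almost contact metric structure `(ξ, η, φ)` on the Riemannian manifold `(M, g)`; the 1-form
`η = g(ξ, ·)` is determined by `ξ`, see `AlmostContactMetric.η`. -/
structure AlmostContactMetric where
  /-- The Reeb vector field. -/
  ξ : Π x : M, TangentSpace I x
  /-- The bundle endomorphism. -/
  φ : Π x : M, TangentSpace I x →L[ℝ] TangentSpace I x
  contMDiff_ξ : CMDiff ∞ (T% ξ)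
  contMDiff_φ : ContMDiff I (I.prod 𝓘(ℝ, E →L[ℝ] E)) ∞
    (fun x ↦ TotalSpace.mk' (E →L[ℝ] E)
      (E := fun x : M ↦ TangentSpace I x →L[ℝ] TangentSpace I x) x (φ x))
  norm_ξ : ∀ x, ‖ξ x‖ = 1
  φ_ξ : ∀ x, φ x (ξ x) = 0
  φ_φ : ∀ x (v : TangentSpace I x), φ x (φ x v) = -v + inner ℝ (ξ x) v • ξ x
  inner_φ_φ : ∀ x (v w : TangentSpace I x),
    inner ℝ (φ x v) (φ x w) = inner ℝ v w - inner ℝ (ξ x) v * inner ℝ (ξ x) w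

namespace AlmostContactMetric

variable (S : AlmostContactMetric I M)

/-- The 1-form `η = g(ξ, ·)`. -/
def η (x : M) : TangentSpace I x →L[ℝ] ℝ := innerSL ℝ (S.ξ x)

/-- The fundamental 2-form `F = g(φ ·, ·)`. -/
def F (x : M) : TangentSpace I x →L[ℝ] TangentSpace I x →L[ℝ] ℝ := innerSL ℝ ∘L S.φ x

/-- The vector field `φ X`. -/
def φField (X : Π x : M, TangentSpace I x) (x : M) : TangentSpace I x := S.φ x (X x)

/-- The Sasaki-Hatakeyama tensor evaluated on vector fields. -/
def sasakiHatakeyama (X Y : Π x : M, TangentSpace I x) (x : M) : TangentSpace I x :=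
  mlieBracket I (S.φField X) (S.φField Y) x + S.φ x (S.φ x (mlieBracket I X Y x))
    - S.φ x (mlieBracket I (S.φField X) Y x) - S.φ x (mlieBracket I X (S.φField Y) x)
    + extDerivOne S.η X Y x • S.ξ x

/-- The structure is normal: the Sasaki-Hatakeyama tensor vanishes. -/
def IsNormal : Prop :=
  ∀ (x : M) (X Y : Π y : M, TangentSpace I y), MDiffAt (T% X) x → MDiffAt (T% Y) x →
    S.sasakiHatakeyama X Y x = 0

/-- The torsion 3-form `c = η ∧ dη + d^φ F`, where `d^φ F = dF(φ ·, φ ·, φ ·)`, evaluated on vector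
fields. -/
def torsionForm (X Y Z : Π x : M, TangentSpace I x) (x : M) : ℝ :=
  (S.η x (X x) * extDerivOne S.η Y Z x + S.η x (Y x) * extDerivOne S.η Z X x
    + S.η x (Z x) * extDerivOne S.η X Y x)
  + extDerivTwo S.F (S.φField X) (S.φField Y) (S.φField Z) x

theorem mdifferentiableAt_φField {x : M} {X : Π x : M, TangentSpace I x}
    (hX : MDiffAt (T% X) x) : MDiffAt (T% (S.φField X)) x :=
  MDifferentiableAt.clm_bundle_apply (b := id) (E₁ := fun x : M ↦ TangentSpace I x)
    (E₂ := fun x : M ↦ TangentSpace I x)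
    (S.contMDiff_φ.contMDiffAt.mdifferentiableAt (by simp)) hX

theorem mdifferentiableAt_η {x : M} (Y : Π x : M, TangentSpace I x) (hY : MDiffAt (T% Y) x) :
    MDiffAt (fun y ↦ S.η y (Y y)) x :=
  mdifferentiableAt_inner (S.contMDiff_ξ.contMDiffAt.mdifferentiableAt (by simp)) hY

theorem mdifferentiableAt_F {x : M} (Y Z : Π x : M, TangentSpace I x)
    (hY : MDiffAt (T% Y) x) (hZ : MDiffAt (T% Z) x) :
    MDiffAt (fun y ↦ S.F y (Y y) (Z y)) x :=
  mdifferentiableAt_inner (S.mdifferentiableAt_φField hY) hZ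

theorem η_φ (x : M) (v : TangentSpace I x) : inner ℝ (S.ξ x) (S.φ x v) = 0 := by
  have h1 := S.φ_φ x (S.φ x v)
  rw [S.φ_φ x v, map_add, map_smul, S.φ_ξ, map_neg, smul_zero, add_zero, left_eq_add] at h1
  have h2 : S.ξ x ≠ 0 := fun h ↦ by simpa [h] using S.norm_ξ x
  exact (smul_eq_zero.1 h1).resolve_right h2

theorem F_swap (x : M) (u v : TangentSpace I x) : S.F x u v = - S.F x v u := by
  have h := S.inner_φ_φ x u (S.φ x v)
  rw [S.φ_φ, S.η_φ, inner_add_right, inner_neg_right, real_inner_smul_right,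
    real_inner_comm (S.ξ x) (S.φ x u), S.η_φ, real_inner_comm (S.φ x v) u] at h
  change inner ℝ (S.φ x u) v = - inner ℝ (S.φ x v) u
  linarith

theorem torsionForm_cyclic (X Y Z : Π x : M, TangentSpace I x) (x : M) :
    S.torsionForm X Y Z x = S.torsionForm Y Z X x := by
  simp only [torsionForm]
  rw [extDerivTwo_cyclic]
  ring

theorem torsionForm_tensorial {x : M} {Y Z : Π x : M, TangentSpace I x}
    (hY : MDiffAt (T% Y) x) (hZ : MDiffAt (T% Z) x) :
    TensorialAt I E (fun X ↦ S.torsionForm X Y Z x) x where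
  smul {f X} hf hX := by
    have h1 := (extDerivOne_tensorial S.mdifferentiableAt_η Y).smul hf hX
    have h2 := (extDerivOne_tensorial S.mdifferentiableAt_η Z).smul hf hX
    have h3 := (extDerivTwo_tensorial S.mdifferentiableAt_F S.F_swap
      (S.mdifferentiableAt_φField hY) (S.mdifferentiableAt_φField hZ)).smul hf
      (S.mdifferentiableAt_φField hX)
    have e : S.φField (f • X) = f • S.φField X := by ext y; simp [φField]
    simp only [torsionForm, extDerivOne_swap S.η Z, e, h1, h2, h3, Pi.smul_apply', map_smul,
      smul_eq_mul]
    ring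
  add {X X'} hX hX' := by
    have h1 := (extDerivOne_tensorial S.mdifferentiableAt_η Y).add hX hX'
    have h2 := (extDerivOne_tensorial S.mdifferentiableAt_η Z).add hX hX'
    have h3 := (extDerivTwo_tensorial S.mdifferentiableAt_F S.F_swap
      (S.mdifferentiableAt_φField hY) (S.mdifferentiableAt_φField hZ)).add
      (S.mdifferentiableAt_φField hX) (S.mdifferentiableAt_φField hX')
    have e : S.φField (X + X') = S.φField X + S.φField X' := by ext y; simp [φField]
    simp only [torsionForm, extDerivOne_swap S.η Z, e, h1, h2, h3, Pi.add_apply, map_add]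
    ring

/-- The torsion 3-form `c` as a trilinear form on each tangent space. -/
def torsionTensor (x : M) :
    TangentSpace I x →L[ℝ] TangentSpace I x →L[ℝ] TangentSpace I x →L[ℝ] ℝ :=
  trilinearOfTensorial (fun X Y Z ↦ S.torsionForm X Y Z x) x
    (fun _ _ hY hZ ↦ S.torsionForm_tensorial hY hZ)
    (fun X Z hX hZ ↦ by
      simpa only [S.torsionForm_cyclic X] using S.torsionForm_tensorial hZ hX)
    (fun X Y hX hY ↦ by
      simpa only [← S.torsionForm_cyclic _ X Y] using S.torsionForm_tensorial hX hY)

theorem torsionTensor_apply {x : M} {X Y Z : Π x : M, TangentSpace I x}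
    (hX : MDiffAt (T% X) x) (hY : MDiffAt (T% Y) x) (hZ : MDiffAt (T% Z) x) :
    S.torsionTensor x (X x) (Y x) (Z x) = S.torsionForm X Y Z x :=
  trilinearOfTensorial_apply _ _ _ hX hY hZ

/-- The connection `∇` with `g(∇_X Y, Z) = g(∇^LC_X Y, Z) + c(X, Y, Z) / 2`; recall that `D Y x u`
is `D_u Y` at `x`. -/
def torsionConnection : CovariantDerivative I E (fun x : M ↦ TangentSpace I x) :=
  (leviCivita I M).addOneForm fun x ↦
    (2⁻¹ : ℝ) • (ContinuousLinearMap.compL ℝ (TangentSpace I x) (TangentSpace I x →L[ℝ] ℝ)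
      (TangentSpace I x) (sharp x) ∘L (S.torsionTensor x).flip)

theorem inner_torsionConnection {x : M} {X Y Z : Π x : M, TangentSpace I x}
    (hX : MDiffAt (T% X) x) (hY : MDiffAt (T% Y) x) (hZ : MDiffAt (T% Z) x) :
    inner ℝ (S.torsionConnection Y x (X x)) (Z x)
      = inner ℝ (leviCivita I M Y x (X x)) (Z x) + S.torsionForm X Y Z x / 2 := by
  rw [← S.torsionTensor_apply hX hY hZ]
  simp [torsionConnection, CovariantDerivative.addOneForm, inner_add_left, real_inner_smul_left,
    inner_sharp]
  ring

/-- The Reeb field is Killing: `L_ξ g = 0`. -/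
def IsKillingReeb : Prop :=
  ∀ (x : M) (X Y : Π y : M, TangentSpace I y), MDiffAt (T% X) x → MDiffAt (T% Y) x →
    d% (fun y ↦ inner ℝ (X y) (Y y)) x (S.ξ x) - inner ℝ (mlieBracket I S.ξ X x) (Y x)
      - inner ℝ (X x) (mlieBracket I S.ξ Y x) = 0

/-- A Sasaki with torsion (ST) structure: normal, with Killing Reeb field. -/
def IsST : Prop := S.IsNormal ∧ S.IsKillingReeb

/-- `D` is an almost contact metric connection: a smooth connection with `D g = 0`, `D ξ = 0` and
`D φ = 0`. -/
structure IsAlmostContactMetricConnection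
    (D : CovariantDerivative I E (fun x : M ↦ TangentSpace I x)) : Prop where
  smooth : CovariantDerivative.ContMDiffCovariantDerivative D ∞
  metric : PreservesMetric D
  reeb : ∀ x, D S.ξ x = 0
  endo : ∀ (x : M) (Y : Π y : M, TangentSpace I y), MDiffAt (T% Y) x →
    ∀ u : TangentSpace I x, D (S.φField Y) x u = S.φ x (D Y x u)

end AlmostContactMetric

/-- `D` has skew torsion: `(X, Y, Z) ↦ g(T(X, Y), Z)` is totally skew (it is skew in `X, Y` by
definition of `T`). -/
def HasSkewTorsion (D : CovariantDerivative I E (fun x : M ↦ TangentSpace I x)) : Prop :=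
  ∀ (x : M) (u v w : TangentSpace I x), inner ℝ (D.torsion x u v) w = - inner ℝ (D.torsion x u w) v

end

end SasakiTorsion

/-!
Write `A u v = (∇_u φ) v` and `B u = ∇_u ξ` for the Levi-Civita connection `∇`. If the structure is
normal and `ξ` is Killing, then `g(A (φ u) v, w) + g(A u v, φ w) + g(B u, v) η(w)` is symmetric in
`u, v` by normality and skew in `v, w` because `φ` is skew, so it vanishes. This identity puts the
torsion form `c` in closed form, from which `ξ` and `φ` are parallel for `∇ + c / 2` by linear
algebra at each point. Conversely, a vector field that is parallel for a metric connection with skew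
torsion is Killing.
-/

namespace SasakiTorsion

open scoped RealInnerProductSpace

noncomputable section

section Algebra

theorem eq_zero_of_symm_of_skew {α G : Type*} [AddGroup G] [IsAddTorsionFree G]
    {K : α → α → α → G} (hsymm : ∀ u v w, K u v w = K v u w)
    (hskew : ∀ u v w, K u v w = -K u w v) (u v w : α) : K u v w = 0 := by
  refine self_eq_neg.1 ?_
  calc K u v w = -K v w u := by rw [hsymm, hskew]
    _ = K w u v := by rw [hsymm, hskew, neg_neg]
    _ = -K u v w := by rw [hsymm, hskew]

variable {V : Type*} [NormedAddCommGroup V] [InnerProductSpace ℝ V]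

/-- The value at a point of `η ∧ dη + d^φ F`, written through `B u = ∇_u ξ` and
`A u v = (∇_u φ) v` for the Levi-Civita connection `∇`. -/
def contactTorsion (ξ : V) (φ B : V →L[ℝ] V) (A : V →L[ℝ] V →L[ℝ] V) (u v w : V) : ℝ :=
  ⟪ξ, u⟫ * (⟪B v, w⟫ - ⟪B w, v⟫) + ⟪ξ, v⟫ * (⟪B w, u⟫ - ⟪B u, w⟫)
    + ⟪ξ, w⟫ * (⟪B u, v⟫ - ⟪B v, u⟫)
    + (⟪A (φ u) (φ v), φ w⟫ + ⟪A (φ v) (φ w), φ u⟫ + ⟪A (φ w) (φ u), φ v⟫)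

/-- The pointwise identities satisfied by `ξ`, `φ`, `B u = ∇_u ξ` and `A u v = (∇_u φ) v`, with `∇`
the Levi-Civita connection, for a normal almost contact metric structure whose Reeb field is
Killing. -/
structure IsNormalKillingAt (ξ : V) (φ B : V →L[ℝ] V) (A : V →L[ℝ] V →L[ℝ] V) : Prop where
  inner_ξ : ⟪ξ, ξ⟫ = 1
  φ_ξ : φ ξ = 0
  φ_φ : ∀ v, φ (φ v) = -v + ⟪ξ, v⟫ • ξ
  φ_skew : ∀ u v, ⟪φ u, v⟫ = -⟪u, φ v⟫
  A_skew : ∀ u v w, ⟪A u v, w⟫ = -⟪v, A u w⟫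
  A_φ : ∀ u v, A u (φ v) = -φ (A u v) + ⟪B u, v⟫ • ξ + ⟪ξ, v⟫ • B u
  B_skew : ∀ u v, ⟪B u, v⟫ = -⟪u, B v⟫
  normal : ∀ u v, A (φ u) v - A (φ v) u - φ (A u v) + φ (A v u) + (⟪B u, v⟫ - ⟪B v, u⟫) • ξ = 0

theorem contactTorsion_cyclic (ξ : V) (φ B : V →L[ℝ] V) (A : V →L[ℝ] V →L[ℝ] V) (u v w : V) :
    contactTorsion ξ φ B A u v w = contactTorsion ξ φ B A v w u := by
  simp only [contactTorsion]
  ring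

theorem contactTorsion_swap_right {ξ : V} {φ B : V →L[ℝ] V} {A : V →L[ℝ] V →L[ℝ] V}
    (hA : ∀ u v w, ⟪A u v, w⟫ = -⟪v, A u w⟫) (u v w : V) :
    contactTorsion ξ φ B A u v w = -contactTorsion ξ φ B A u w v := by
  have hA' (u v w : V) : ⟪A u v, w⟫ = -⟪A u w, v⟫ := by rw [hA, real_inner_comm]
  simp only [contactTorsion]
  linear_combination hA' (φ u) (φ v) (φ w) + hA' (φ v) (φ w) (φ u) + hA' (φ w) (φ u) (φ v)

namespace IsNormalKillingAt

variable {ξ : V} {φ B : V →L[ℝ] V} {A : V →L[ℝ] V →L[ℝ] V} (h : IsNormalKillingAt ξ φ B A)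
include h

theorem inner_φ_ξ (u : V) : ⟪φ u, ξ⟫ = 0 := by rw [h.φ_skew, h.φ_ξ, inner_zero_right, neg_zero]

theorem inner_ξ_φ (u : V) : ⟪ξ, φ u⟫ = 0 := by rw [real_inner_comm, h.inner_φ_ξ]

theorem B_swap (u v : V) : ⟪B u, v⟫ = -⟪B v, u⟫ := by rw [h.B_skew, real_inner_comm]

theorem A_swap (u v w : V) : ⟪A u v, w⟫ = -⟪A u w, v⟫ := by rw [h.A_skew, real_inner_comm]

theorem φ_A_ξ_eq (u : V) : φ (A u ξ) = ⟪B u, ξ⟫ • ξ + B u := by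
  have hφξ := h.A_φ u ξ
  rw [h.φ_ξ, map_zero, h.inner_ξ, one_smul] at hφξ
  linear_combination (norm := module) hφξ

theorem inner_B_ξ (u : V) : ⟪B u, ξ⟫ = 0 := by
  have hφ := h.inner_φ_ξ (A u ξ)
  rw [h.φ_A_ξ_eq, inner_add_left, real_inner_smul_left, h.inner_ξ] at hφ
  linarith

theorem B_ξ : B ξ = 0 :=
  ext_inner_right ℝ fun v ↦ by rw [h.B_swap, h.inner_B_ξ, neg_zero, inner_zero_left]

theorem A_ξ_right (u : V) : A u ξ = -φ (B u) := by
  have horth : ⟪ξ, A u ξ⟫ = 0 := self_eq_neg.1 ((real_inner_comm _ _).trans (h.A_skew u ξ ξ))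
  have hφ : φ (A u ξ) = B u := by rw [h.φ_A_ξ_eq, h.inner_B_ξ, zero_smul, zero_add]
  rw [← hφ, h.φ_φ, horth, zero_smul, add_zero, neg_neg]

theorem inner_A_ξ_right (u v : V) : ⟪A u ξ, v⟫ = ⟪B u, φ v⟫ := by
  rw [h.A_ξ_right, inner_neg_left, h.φ_skew, neg_neg]

theorem inner_A_ξ (u v : V) : ⟪A u v, ξ⟫ = -⟪B u, φ v⟫ := by rw [h.A_swap, h.inner_A_ξ_right]

theorem inner_A_φ (u v w : V) :
    ⟪A u (φ v), w⟫ = ⟪A u v, φ w⟫ + ⟪B u, v⟫ * ⟪ξ, w⟫ + ⟪ξ, v⟫ * ⟪B u, w⟫ := by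
  rw [h.A_φ, inner_add_left, inner_add_left, inner_neg_left, real_inner_smul_left,
    real_inner_smul_left, h.φ_skew, neg_neg]

theorem inner_A_φ_ξ (u v : V) : ⟪A u (φ v), ξ⟫ = ⟪B u, v⟫ := by
  rw [h.inner_A_φ, h.φ_ξ, inner_zero_right, h.inner_ξ, h.inner_B_ξ]
  ring

theorem inner_A_φ_φ (u v w : V) :
    ⟪A u (φ v), φ w⟫ = -⟪A u v, w⟫ - ⟪ξ, w⟫ * ⟪B u, φ v⟫ + ⟪ξ, v⟫ * ⟪B u, φ w⟫ := by
  rw [h.inner_A_φ, h.φ_φ, inner_add_right, inner_neg_right, real_inner_smul_right,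
    h.inner_A_ξ, h.inner_ξ_φ]
  ring

theorem inner_normal (u v w : V) :
    ⟪A (φ u) v, w⟫ - ⟪A (φ v) u, w⟫ + ⟪A u v, φ w⟫ - ⟪A v u, φ w⟫
      + (⟪B u, v⟫ - ⟪B v, u⟫) * ⟪ξ, w⟫ = 0 := by
  have hw := congrArg (fun t ↦ ⟪t, w⟫) (h.normal u v)
  simp only [inner_add_left, inner_sub_left, real_inner_smul_left, inner_zero_left, h.φ_skew] at hw
  linear_combination hw

theorem inner_A_φ_left (u v w : V) : ⟪A (φ u) v, w⟫ = -⟪A u v, φ w⟫ - ⟪B u, v⟫ * ⟪ξ, w⟫ := by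
  have hzero := eq_zero_of_symm_of_skew
    (K := fun u v w ↦ ⟪A (φ u) v, w⟫ + ⟪A u v, φ w⟫ + ⟪B u, v⟫ * ⟪ξ, w⟫)
    (fun u v w ↦ by linear_combination h.inner_normal u v w)
    (fun u v w ↦ by linear_combination h.A_swap (φ u) v w + h.A_swap u v (φ w) - h.inner_A_φ u w v)
    u v w
  linear_combination hzero

theorem A_φ_left (u v : V) : A (φ u) v = φ (A u v) - ⟪B u, v⟫ • ξ :=
  ext_inner_right ℝ fun w ↦ by
    rw [h.inner_A_φ_left, inner_sub_left, real_inner_smul_left, h.φ_skew]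

theorem A_ξ_left (v : V) : A ξ v = 0 := by
  have hφ : φ (A ξ v) = 0 := by
    simpa only [h.φ_ξ, h.B_ξ, map_zero, _root_.zero_apply, inner_zero_left, zero_smul, sub_zero,
      eq_comm] using h.A_φ_left ξ v
  have horth : ⟪ξ, A ξ v⟫ = 0 := by
    rw [real_inner_comm, h.inner_A_ξ, h.B_ξ, inner_zero_left, neg_zero]
  simpa only [hφ, horth, map_zero, zero_smul, add_zero, zero_eq_neg] using h.φ_φ (A ξ v)

theorem inner_B_φ (u v : V) : ⟪B (φ u), v⟫ = -⟪B u, φ v⟫ := by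
  have hξ := h.inner_A_φ_left u (φ v) ξ
  rw [h.inner_A_φ_ξ, h.φ_ξ, inner_zero_right, h.inner_ξ] at hξ
  linear_combination hξ

theorem contactTorsion_eq (u v w : V) :
    contactTorsion ξ φ B A u v w =
      (⟪A u (φ v), w⟫ + ⟪ξ, u⟫ * ⟪B v, w⟫) + (⟪A v (φ w), u⟫ + ⟪ξ, v⟫ * ⟪B w, u⟫)
        + (⟪A w (φ u), v⟫ + ⟪ξ, w⟫ * ⟪B u, v⟫) := by
  have hφφφ (u v w : V) : ⟪A (φ u) (φ v), φ w⟫ = ⟪A u (φ v), w⟫ - ⟪ξ, w⟫ * ⟪B u, v⟫ := by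
    rw [h.inner_A_φ_left, h.φ_φ, inner_add_right, inner_neg_right, real_inner_smul_right,
      h.inner_A_φ_ξ, h.inner_ξ_φ]
    ring
  rw [contactTorsion, hφφφ, hφφφ, hφφφ]
  linear_combination -⟪ξ, u⟫ * h.B_swap w v - ⟪ξ, v⟫ * h.B_swap u w - ⟪ξ, w⟫ * h.B_swap v u

theorem contactTorsion_ξ (u w : V) : contactTorsion ξ φ B A u ξ w = -2 * ⟪B u, w⟫ := by
  simp only [h.contactTorsion_eq, h.φ_ξ, map_zero, inner_zero_left, h.B_ξ, h.A_ξ_left,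
    h.inner_A_φ_ξ, h.inner_ξ, h.inner_B_ξ]
  linear_combination 2 * h.B_swap w u

/-- The pointwise form of `∇φ = 0` for the connection `∇` with torsion `η ∧ dη + d^φ F`. -/
theorem two_mul_inner_A_add_contactTorsion (u v w : V) :
    2 * ⟪A u v, w⟫ + contactTorsion ξ φ B A u (φ v) w + contactTorsion ξ φ B A u v (φ w) = 0 := by
  have hAφφ (u v w : V) : ⟪A u (φ (φ v)), w⟫ = -⟪A u v, w⟫ + ⟪ξ, v⟫ * ⟪B u, φ w⟫ := by
    rw [h.φ_φ, map_add, map_neg, map_smul, inner_add_left, inner_neg_left, real_inner_smul_left,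
      h.inner_A_ξ_right]
  have hAφ_φ (u v w : V) : ⟪A (φ v) (φ w), u⟫ = -⟪A v (φ w), φ u⟫ - ⟪ξ, u⟫ * ⟪B v, φ w⟫ := by
    rw [h.inner_A_φ_left, mul_comm]
  rw [h.contactTorsion_eq, h.contactTorsion_eq, hAφφ u v w, hAφφ v w u, hAφ_φ u v w, hAφ_φ v w u,
    h.inner_A_φ_φ u v w, h.inner_A_φ_φ v w u, h.inner_A_φ_φ w u v, h.inner_ξ_φ, h.inner_ξ_φ]
  linear_combination
    ⟪ξ, u⟫ * h.inner_B_φ v w + ⟪ξ, v⟫ * (2 * h.B_swap (φ w) u - h.inner_B_φ w u)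

end IsNormalKillingAt

end Algebra

section Smoothness

variable {𝕜 : Type*} [NontriviallyNormedField 𝕜]
  {E : Type*} [NormedAddCommGroup E] [NormedSpace 𝕜 E]
  {H : Type*} [TopologicalSpace H] {I : ModelWithCorners 𝕜 E H}
  {M : Type*} [TopologicalSpace M] [ChartedSpace H M] {n : ℕ∞ω} {x₀ : M}

theorem contMDiffAt_of_clm_apply {F G : Type*} [NormedAddCommGroup F] [NormedSpace 𝕜 F]
    [CompleteSpace F] [NormedAddCommGroup G] [NormedSpace 𝕜 G] {A : M → F →L[𝕜] G} {c : M → F}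
    (hA : CMDiffAt n A x₀) (hinv : (A x₀).IsInvertible) (hc : CMDiffAt n (fun y ↦ A y (c y)) x₀) :
    CMDiffAt n c x₀ := by
  obtain ⟨e, he⟩ := hinv
  have hsmooth : CMDiffAt n (fun y ↦ (A y).inverse) x₀ :=
    (he ▸ contDiffAt_map_inverse e).contMDiffAt.comp x₀ hA
  refine (hsmooth.clm_apply hc).congr_of_eventuallyEq ?_
  have hnear : ∀ᶠ y in nhds x₀, A y ∈ Set.range ((↑) : (F ≃L[𝕜] G) → F →L[𝕜] G) :=
    hA.continuousAt.eventually_mem (he ▸ ContinuousLinearEquiv.nhds e)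
  filter_upwards [hnear] with y hy
  obtain ⟨e', he'⟩ := hy
  simp [← he']

theorem contMDiffAt_of_mulVec [CompleteSpace 𝕜] {ι : Type*} [Fintype ι] [DecidableEq ι]
    {A : M → Matrix ι ι 𝕜} {c : M → ι → 𝕜} (hA : ∀ i j, CMDiffAt n (fun y ↦ A y i j) x₀)
    (hA₀ : IsUnit (A x₀)) (hc : ∀ i, CMDiffAt n (fun y ↦ (A y).mulVec (c y) i) x₀) (i : ι) :
    CMDiffAt n (fun y ↦ c y i) x₀ := by
  let L : (ι → ι → 𝕜) →L[𝕜] (ι → 𝕜) →L[𝕜] ι → 𝕜 := LinearMap.toContinuousLinearMap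
    (LinearMap.toContinuousLinearMap.toLinearMap ∘ₗ Matrix.mulVecBilin 𝕜 𝕜)
  have hL : ContMDiffAt I 𝓘(𝕜, (ι → 𝕜) →L[𝕜] ι → 𝕜) n (fun y ↦ L (A y)) x₀ :=
    L.contMDiff.contMDiffAt.comp x₀
      (contMDiffAt_pi_space.2 fun i ↦ contMDiffAt_pi_space.2 fun j ↦ hA i j)
  have hinv : (L (A x₀)).IsInvertible :=
    ⟨(Matrix.toLin'OfInv hA₀.val_inv_mul hA₀.mul_val_inv).toContinuousLinearEquiv,
      ContinuousLinearMap.ext fun _ ↦ rfl⟩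
  exact contMDiffAt_pi_space.1
    (contMDiffAt_of_clm_apply hL hinv (contMDiffAt_pi_space.2 hc)) i

variable {F : Type*} [NormedAddCommGroup F] [NormedSpace 𝕜 F]
  {V : M → Type*} [TopologicalSpace (TotalSpace F V)] [∀ x, AddCommGroup (V x)]
  [∀ x, Module 𝕜 (V x)] [∀ x, TopologicalSpace (V x)] [FiberBundle F V] [VectorBundle 𝕜 F V]
  {F' : Type*} [NormedAddCommGroup F'] [NormedSpace 𝕜 F']
  {V' : M → Type*} [TopologicalSpace (TotalSpace F' V')] [∀ x, AddCommGroup (V' x)]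
  [∀ x, Module 𝕜 (V' x)] [∀ x, TopologicalSpace (V' x)] [FiberBundle F' V'] [VectorBundle 𝕜 F' V']

theorem eventually_mdifferentiableAt_section [IsManifold I 1 M] [ContMDiffVectorBundle 1 F V I]
    {s : Π x : M, V x} (hs : CMDiffAt n (T% s) x₀) (hn : 1 ≤ n) :
    ∀ᶠ x in nhds x₀, MDiffAt (T% s) x :=
  ((contMDiffAt_iff_contMDiffAt_nhds (by simp)).1 (hs.of_le hn)).mono
    fun _ hx ↦ hx.mdifferentiableAt one_ne_zero

theorem contMDiffAt_hom_of_apply [CompleteSpace 𝕜] [FiniteDimensional 𝕜 F]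
    [ContMDiffVectorBundle n F V I] [ContMDiffVectorBundle n F' V' I]
    [∀ x, IsTopologicalAddGroup (V' x)] [∀ x, ContinuousSMul 𝕜 (V' x)]
    {Φ : Π x : M, V x →L[𝕜] V' x}
    (h : ∀ s : Π x : M, V x, CMDiffAt n (T% s) x₀ → CMDiffAt n (T% (fun y ↦ Φ y (s y))) x₀) :
    ContMDiffAt I (I.prod 𝓘(𝕜, F →L[𝕜] F')) n
      (fun x ↦ TotalSpace.mk' (F →L[𝕜] F') (E := fun x ↦ V x →L[𝕜] V' x) x (Φ x)) x₀ := by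
  let e := trivializationAt F V x₀
  let e' := trivializationAt F' V' x₀
  let b := Module.finBasis 𝕜 F
  have hx : x₀ ∈ e.baseSet := mem_baseSet_trivializationAt F V x₀
  have hx' : x₀ ∈ e'.baseSet := mem_baseSet_trivializationAt F' V' x₀
  rw [contMDiffAt_hom_bundle]
  refine ⟨contMDiffAt_id, ?_⟩
  -- In the local frame induced by `b`, `Φ = ∑ i, bᵢ* ⊗ Φ bᵢ`.
  have hs (i) := h _ (contMDiffAt_localFrame_of_mem (I := I) n e b i hx)
  simp only [e'.contMDiffAt_section_iff hx'] at hs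
  have hsum : CMDiffAt n (fun y ↦ ∑ i, ContinuousLinearMap.smulRightL 𝕜 F F'
      (LinearMap.toContinuousLinearMap (b.coord i)) (e' ⟨y, Φ y (e.localFrame b i y)⟩).2) x₀ :=
    ContMDiffAt.sum fun i _ ↦ (ContinuousLinearMap.contMDiff _).contMDiffAt.comp x₀ (hs i)
  refine hsum.congr_of_eventuallyEq ?_
  filter_upwards [e.open_baseSet.mem_nhds hx, e'.open_baseSet.mem_nhds hx'] with y hy hy'
  refine ContinuousLinearMap.coe_injective (b.ext fun i ↦ ?_)
  have hsymm : (e.continuousLinearEquivAt 𝕜 y hy).symm (b i) = e.localFrame b i y := by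
    rw [e.localFrame_apply_of_mem_baseSet b hy]
    rfl
  change ContinuousLinearMap.inCoordinates F _ F' _ x₀ y x₀ y (Φ y) (b i) = _
  rw [ContinuousLinearMap.inCoordinates_eq hy hy']
  change e'.continuousLinearEquivAt 𝕜 y hy'
    (Φ y ((e.continuousLinearEquivAt 𝕜 y hy).symm (b i))) = _
  rw [hsymm]
  simp [Finsupp.single_apply]

end Smoothness

section RiemannianSmoothness

variable {E : Type*} [NormedAddCommGroup E] [NormedSpace ℝ E]
  {H : Type*} [TopologicalSpace H] {I : ModelWithCorners ℝ E H}
  {M : Type*} [TopologicalSpace M] [ChartedSpace H M] {n : ℕ∞ω} {x₀ : M}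

theorem contMDiffAt_of_inner {F : Type*} [NormedAddCommGroup F] [NormedSpace ℝ F]
    [FiniteDimensional ℝ F]
    {V : M → Type*} [TopologicalSpace (TotalSpace F V)]
    [∀ x, NormedAddCommGroup (V x)] [∀ x, InnerProductSpace ℝ (V x)] [FiberBundle F V]
    [VectorBundle ℝ F V] [ContMDiffVectorBundle n F V I]
    [IsContMDiffRiemannianBundle I n F V] {s : Π x : M, V x}
    (h : ∀ t : Π x : M, V x, CMDiffAt n (T% t) x₀ → CMDiffAt n (fun y ↦ ⟪s y, t y⟫) x₀) :
    CMDiffAt n (T% s) x₀ := by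
  classical
  let e := trivializationAt F V x₀
  let b := Module.finBasis ℝ F
  have hx : x₀ ∈ e.baseSet := mem_baseSet_trivializationAt F V x₀
  have hb (i) : CMDiffAt n (T% (e.localFrame b i)) x₀ := contMDiffAt_localFrame_of_mem n _ b i hx
  have hframe := e.isLocalFrameOn_localFrame_baseSet I n b
  refine hframe.contMDiffAt_of_coeff ?_ (e.open_baseSet.mem_nhds hx)
  refine contMDiffAt_of_mulVec (A := fun y ↦ Matrix.gram ℝ fun i ↦ e.localFrame b i y)
    (c := fun y i ↦ hframe.coeff i y (s y)) (fun i j ↦ ?_) ?_ fun j ↦ ?_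
  · exact ContMDiffAt.inner_bundle (b := id) (hb i) (hb j)
  · exact (Matrix.posDef_gram_of_linearIndependent (hframe.linearIndependent hx)).isUnit
  · refine (h _ (hb j)).congr_of_eventuallyEq ?_
    filter_upwards [hframe.eventually_eq_sum_coeff_smul s (e.open_baseSet.mem_nhds hx)] with y hy
    conv_rhs => rw [real_inner_comm, hy, inner_sum]
    simp only [Matrix.mulVec, dotProduct, Matrix.gram_apply, real_inner_smul_right, mul_comm]

end RiemannianSmoothness

section EndomorphismFields

variable {𝕜 : Type*} [NontriviallyNormedField 𝕜]
  {E : Type*} [NormedAddCommGroup E] [NormedSpace 𝕜 E]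
  {H : Type*} [TopologicalSpace H] {I : ModelWithCorners 𝕜 E H}
  {M : Type*} [TopologicalSpace M] [ChartedSpace H M]
  {F : Type*} [NormedAddCommGroup F] [NormedSpace 𝕜 F]
  {V : M → Type*} [TopologicalSpace (TotalSpace F V)] [∀ x, AddCommGroup (V x)]
  [∀ x, TopologicalSpace (V x)] [FiberBundle F V] {x : M}

variable (I F) in
theorem exists_mdifferentiableAt_section (v : V x) :
    ∃ s : Π y : M, V y, s x = v ∧ MDiffAt (T% s) x :=
  ⟨extend F v, extend_apply_self .., mdifferentiableAt_extend ..⟩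

variable [∀ x, Module 𝕜 (V x)] [VectorBundle 𝕜 F V] [ContMDiffVectorBundle 1 F V I]
  [FiniteDimensional 𝕜 F] [CompleteSpace 𝕜] [∀ x, IsTopologicalAddGroup (V x)]
  [∀ x, ContinuousSMul 𝕜 (V x)]
  (D : CovariantDerivative I F V) {Φ : Π x : M, V x →L[𝕜] V x}
  (hΦ : MDifferentiableAt I (I.prod 𝓘(𝕜, F →L[𝕜] F))
    (fun y ↦ TotalSpace.mk' (F →L[𝕜] F) (E := fun y ↦ V y →L[𝕜] V y) y (Φ y)) x)

/-- The covariant derivative of a differentiable endomorphism field `Φ`; as for sections, the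
direction of differentiation comes last: `covDerivEnd D hΦ v u = (D_u Φ) v`. -/
def covDerivEnd : V x →L[𝕜] TangentSpace I x →L[𝕜] V x :=
  TensorialAt.mkHom (I := I) (F := F) (fun s ↦ D (fun y ↦ Φ y (s y)) x - Φ x ∘L D s x) x
    { smul := fun {f s} hf hs ↦ by
        have hΦs : MDiffAt (T% fun y ↦ Φ y (s y)) x := hΦ.clm_bundle_apply (b := id) hs
        have hcomm : (fun y ↦ Φ y ((f • s) y)) = f • fun y ↦ Φ y (s y) := by
          ext y
          exact map_smul _ _ _
        rw [hcomm, D.isCovariantDerivativeOnUniv.leibniz hs hf,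
          D.isCovariantDerivativeOnUniv.leibniz hΦs hf]
        ext u
        simp [smul_sub]
      add := fun {s t} hs ht ↦ by
        have hΦs : MDiffAt (T% fun y ↦ Φ y (s y)) x := hΦ.clm_bundle_apply (b := id) hs
        have hΦt : MDiffAt (T% fun y ↦ Φ y (t y)) x := hΦ.clm_bundle_apply (b := id) ht
        have hcomm : (fun y ↦ Φ y ((s + t) y)) = (fun y ↦ Φ y (s y)) + fun y ↦ Φ y (t y) := by
          ext y
          exact map_add _ _ _
        rw [hcomm, D.isCovariantDerivativeOnUniv.add hs ht,
          D.isCovariantDerivativeOnUniv.add hΦs hΦt, ContinuousLinearMap.comp_add]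
        abel }

theorem covDeriv_clm_apply {s : Π y : M, V y} (hs : MDiffAt (T% s) x) (u : TangentSpace I x) :
    D (fun y ↦ Φ y (s y)) x u = covDerivEnd D hΦ (s x) u + Φ x (D s x u) := by
  rw [covDerivEnd, TensorialAt.mkHom_apply _ hs]
  simp

end EndomorphismFields

section Nijenhuis

variable {𝕜 : Type*} [NontriviallyNormedField 𝕜]
  {E : Type*} [NormedAddCommGroup E] [NormedSpace 𝕜 E]
  {H : Type*} [TopologicalSpace H] {I : ModelWithCorners 𝕜 E H}
  {M : Type*} [TopologicalSpace M] [ChartedSpace H M]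

/-- The Nijenhuis tensor of an endomorphism field, evaluated on vector fields. -/
def nijenhuis (Φ : Π x : M, TangentSpace I x →L[𝕜] TangentSpace I x)
    (X Y : Π x : M, TangentSpace I x) (x : M) : TangentSpace I x :=
  mlieBracket I (fun y ↦ Φ y (X y)) (fun y ↦ Φ y (Y y)) x + Φ x (Φ x (mlieBracket I X Y x))
    - Φ x (mlieBracket I (fun y ↦ Φ y (X y)) Y x) - Φ x (mlieBracket I X (fun y ↦ Φ y (Y y)) x)

variable [FiniteDimensional 𝕜 E] [CompleteSpace E] [CompleteSpace 𝕜] [IsManifold I 2 M]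
  {D : CovariantDerivative I E (fun x : M ↦ TangentSpace I x)} {x : M}
  {X Y : Π x : M, TangentSpace I x}

theorem mlieBracket_eq_covDeriv_sub (hD : D.torsion = 0)
    (hX : MDiffAt (T% X) x) (hY : MDiffAt (T% Y) x) :
    mlieBracket I X Y x = D Y x (X x) - D X x (Y x) :=
  (D.torsion_eq_zero_iff.1 hD hX hY).symm

theorem nijenhuis_eq_covDerivEnd (hD : D.torsion = 0)
    {Φ : Π x : M, TangentSpace I x →L[𝕜] TangentSpace I x}
    (hΦ : MDifferentiableAt I (I.prod 𝓘(𝕜, E →L[𝕜] E))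
      (fun y ↦ TotalSpace.mk' (E →L[𝕜] E)
        (E := fun y : M ↦ TangentSpace I y →L[𝕜] TangentSpace I y) y (Φ y)) x)
    (hX : MDiffAt (T% X) x) (hY : MDiffAt (T% Y) x) :
    nijenhuis Φ X Y x = covDerivEnd D hΦ (Y x) (Φ x (X x)) - covDerivEnd D hΦ (X x) (Φ x (Y x))
      - Φ x (covDerivEnd D hΦ (Y x) (X x)) + Φ x (covDerivEnd D hΦ (X x) (Y x)) := by
  have hΦX : MDiffAt (T% fun y ↦ Φ y (X y)) x := hΦ.clm_bundle_apply (b := id) hX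
  have hΦY : MDiffAt (T% fun y ↦ Φ y (Y y)) x := hΦ.clm_bundle_apply (b := id) hY
  rw [nijenhuis, mlieBracket_eq_covDeriv_sub hD hΦX hΦY, mlieBracket_eq_covDeriv_sub hD hX hY,
    mlieBracket_eq_covDeriv_sub hD hΦX hY, mlieBracket_eq_covDeriv_sub hD hX hΦY]
  simp only [covDeriv_clm_apply D hΦ hX, covDeriv_clm_apply D hΦ hY, map_sub, map_add]
  abel

end Nijenhuis

section VectorFieldSmoothness

variable {𝕜 : Type*} [NontriviallyNormedField 𝕜]
  {E : Type*} [NormedAddCommGroup E] [NormedSpace 𝕜 E]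
  {H : Type*} [TopologicalSpace H] {I : ModelWithCorners 𝕜 E H}
  {M : Type*} [TopologicalSpace M] [ChartedSpace H M] {x₀ : M}

theorem contMDiffAt_mvfderiv_apply {m n : ℕ∞ω} [IsManifold I n M] [IsManifold I 1 M]
    {F : Type*} [NormedAddCommGroup F] [NormedSpace 𝕜 F]
    {f : M → F} {X : Π x : M, TangentSpace I x} (hf : CMDiffAt n f x₀)
    (hX : CMDiffAt m (T% X) x₀) (hmn : m + 1 ≤ n) : CMDiffAt m (fun y ↦ d% f y (X y)) x₀ := by
  have : IsManifold I (m + 1) M := .of_le hmn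
  have h := ContMDiffAt.clm_apply_of_inCoordinates (b₁ := id) (b₂ := f) (F₁ := E) (F₂ := F)
    (E₁ := fun x : M ↦ TangentSpace I x) (E₂ := fun x : F ↦ TangentSpace 𝓘(𝕜, F) x)
    (ϕ := fun y ↦ mfderiv% f y) (v := X) (hf.mfderiv_const hmn) hX
    (hf.of_le (le_self_add.trans hmn))
  exact (contMDiff_snd_tangentBundle_modelSpace F 𝓘(𝕜, F)).contMDiffAt.comp x₀ h

theorem contMDiffAt_mlieBracket {𝕜 : Type*} [RCLike 𝕜]
    {E : Type*} [NormedAddCommGroup E] [NormedSpace 𝕜 E] [CompleteSpace E]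
    {H : Type*} [TopologicalSpace H] {I : ModelWithCorners 𝕜 E H}
    {M : Type*} [TopologicalSpace M] [ChartedSpace H M] [IsManifold I ∞ M] {x₀ : M}
    {X Y : Π x : M, TangentSpace I x} (hX : CMDiffAt ∞ (T% X) x₀) (hY : CMDiffAt ∞ (T% Y) x₀) :
    CMDiffAt ∞ (T% (mlieBracket I X Y)) x₀ := by
  have : IsManifold I ((⊤ : ℕ∞) + 1) M := by simpa using ‹IsManifold I ∞ M›
  have : IsManifold I (minSmoothness 𝕜 2) M := by
    rw [minSmoothness_of_isRCLikeNormedField]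
    infer_instance
  exact ContMDiffAt.mlieBracket_vectorField (m := ⊤) (n := ⊤) hX hY (by simp)

end VectorFieldSmoothness

section ExteriorDerivativeSmoothness

variable {E : Type*} [NormedAddCommGroup E] [NormedSpace ℝ E] [CompleteSpace E]
  {H : Type*} [TopologicalSpace H] {I : ModelWithCorners ℝ E H}
  {M : Type*} [TopologicalSpace M] [ChartedSpace H M] [IsManifold I ∞ M]
  {x : M} {X Y Z : Π x : M, TangentSpace I x}

theorem contMDiffAt_extDerivOne {α : Π x : M, TangentSpace I x →L[ℝ] ℝ}
    (hα : ∀ Y : Π x : M, TangentSpace I x, CMDiffAt ∞ (T% Y) x →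
      CMDiffAt ∞ (fun y ↦ α y (Y y)) x)
    (hX : CMDiffAt ∞ (T% X) x) (hY : CMDiffAt ∞ (T% Y) x) :
    CMDiffAt ∞ (extDerivOne α X Y) x :=
  ((contMDiffAt_mvfderiv_apply (hα Y hY) hX (by simp)).sub
    (contMDiffAt_mvfderiv_apply (hα X hX) hY (by simp))).sub
    (hα _ (contMDiffAt_mlieBracket hX hY))

theorem contMDiffAt_extDerivTwo {β : Π x : M, TangentSpace I x →L[ℝ] TangentSpace I x →L[ℝ] ℝ}
    (hβ : ∀ Y Z : Π x : M, TangentSpace I x, CMDiffAt ∞ (T% Y) x → CMDiffAt ∞ (T% Z) x →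
      CMDiffAt ∞ (fun y ↦ β y (Y y) (Z y)) x)
    (hX : CMDiffAt ∞ (T% X) x) (hY : CMDiffAt ∞ (T% Y) x) (hZ : CMDiffAt ∞ (T% Z) x) :
    CMDiffAt ∞ (extDerivTwo β X Y Z) x := by
  have hderiv {U V W : Π x : M, TangentSpace I x} (hU : CMDiffAt ∞ (T% U) x)
      (hV : CMDiffAt ∞ (T% V) x) (hW : CMDiffAt ∞ (T% W) x) :
      CMDiffAt ∞ (fun y ↦ d% (fun z ↦ β z (V z) (W z)) y (U y)) x :=
    contMDiffAt_mvfderiv_apply (hβ V W hV hW) hU (by simp)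
  have hbracket {U V W : Π x : M, TangentSpace I x} (hU : CMDiffAt ∞ (T% U) x)
      (hV : CMDiffAt ∞ (T% V) x) (hW : CMDiffAt ∞ (T% W) x) :
      CMDiffAt ∞ (fun y ↦ β y (mlieBracket I U V y) (W y)) x :=
    hβ _ W (contMDiffAt_mlieBracket hU hV) hW
  exact (((((hderiv hX hY hZ).add (hderiv hY hZ hX)).add (hderiv hZ hX hY)).sub
    (hbracket hX hY hZ)).sub (hbracket hY hZ hX)).sub (hbracket hZ hX hY)

end ExteriorDerivativeSmoothness

section RiemannianManifold

variable {E : Type*} [NormedAddCommGroup E] [NormedSpace ℝ E]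
  {H : Type*} [TopologicalSpace H] {I : ModelWithCorners ℝ E H}
  {M : Type*} [TopologicalSpace M] [ChartedSpace H M] [IsManifold I ∞ M]
  [RiemannianBundle (fun x : M ↦ TangentSpace I x)]
  {x : M} {X Y Z : Π x : M, TangentSpace I x}
  {D : CovariantDerivative I E (fun x : M ↦ TangentSpace I x)}

variable [FiniteDimensional ℝ E]

theorem inner_covDerivEnd_of_skew (hD : PreservesMetric D)
    {Φ : Π x : M, TangentSpace I x →L[ℝ] TangentSpace I x}
    (hΦ : MDifferentiableAt I (I.prod 𝓘(ℝ, E →L[ℝ] E)) (fun y ↦ TotalSpace.mk' (E →L[ℝ] E)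
      (E := fun y : M ↦ TangentSpace I y →L[ℝ] TangentSpace I y) y (Φ y)) x)
    (hskew : ∀ (y : M) (u v : TangentSpace I y), ⟪Φ y u, v⟫ = -⟪u, Φ y v⟫)
    (u v w : TangentSpace I x) : ⟪covDerivEnd D hΦ v u, w⟫ = -⟪v, covDerivEnd D hΦ w u⟫ := by
  obtain ⟨U, rfl, hU⟩ := exists_mdifferentiableAt_section I E u
  obtain ⟨V, rfl, hV⟩ := exists_mdifferentiableAt_section I E v
  obtain ⟨W, rfl, hW⟩ := exists_mdifferentiableAt_section I E w
  have hΦV : MDiffAt (T% fun y ↦ Φ y (V y)) x := hΦ.clm_bundle_apply (b := id) hV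
  have hΦW : MDiffAt (T% fun y ↦ Φ y (W y)) x := hΦ.clm_bundle_apply (b := id) hW
  have hleft := hD x U _ W hU hΦV hW
  have hright := hD x U V _ hU hV hΦW
  have hneg : (fun y ↦ ⟪Φ y (V y), W y⟫) = -fun y ↦ ⟪V y, Φ y (W y)⟫ :=
    funext fun y ↦ hskew y _ _
  rw [hneg, mvfderiv_neg, _root_.neg_apply, hright, covDeriv_clm_apply D hΦ hV,
    covDeriv_clm_apply D hΦ hW] at hleft
  simp only [inner_add_left, inner_add_right, hskew] at hleft
  linarith

variable [CompleteSpace E]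

/-- The Lie derivative `L_ξ g` of the metric along `ξ`, evaluated on vector fields. -/
def lieDerivMetric (ξ X Y : Π x : M, TangentSpace I x) (x : M) : ℝ :=
  d% (fun y ↦ ⟪X y, Y y⟫) x (ξ x) - ⟪mlieBracket I ξ X x, Y x⟫ - ⟪X x, mlieBracket I ξ Y x⟫

theorem lieDerivMetric_eq_covDeriv_add_torsion (hD : PreservesMetric D)
    {ξ : Π x : M, TangentSpace I x} (hξ : MDiffAt (T% ξ) x) (hX : MDiffAt (T% X) x)
    (hY : MDiffAt (T% Y) x) :
    lieDerivMetric ξ X Y x = ⟪D ξ x (X x) + D.torsion x (ξ x) (X x), Y x⟫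
      + ⟪X x, D ξ x (Y x) + D.torsion x (ξ x) (Y x)⟫ := by
  rw [lieDerivMetric, hD x ξ X Y hξ hX hY, D.torsion_apply hξ hX, D.torsion_apply hξ hY]
  simp only [inner_add_left, inner_sub_left, inner_add_right, inner_sub_right]
  ring

theorem lieDerivMetric_eq_zero_of_parallel (hD : PreservesMetric D) (hT : HasSkewTorsion D)
    {ξ : Π x : M, TangentSpace I x} (hξ : MDiffAt (T% ξ) x) (hDξ : D ξ x = 0)
    (hX : MDiffAt (T% X) x) (hY : MDiffAt (T% Y) x) : lieDerivMetric ξ X Y x = 0 := by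
  rw [lieDerivMetric_eq_covDeriv_add_torsion hD hξ hX hY, hDξ, _root_.zero_apply,
    _root_.zero_apply, zero_add, zero_add, hT, real_inner_comm, neg_add_cancel]

variable [IsContMDiffRiemannianBundle I ∞ E (fun x : M ↦ TangentSpace I x)]

omit [FiniteDimensional ℝ E] [CompleteSpace E] in
theorem contMDiffAt_inner (hX : CMDiffAt ∞ (T% X) x) (hY : CMDiffAt ∞ (T% Y) x) :
    CMDiffAt ∞ (fun y ↦ ⟪X y, Y y⟫) x :=
  ContMDiffAt.inner_bundle (E := fun x : M ↦ TangentSpace I x) (b := id) hX hY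

omit [FiniteDimensional ℝ E] in
theorem contMDiffAt_koszul (hX : CMDiffAt ∞ (T% X) x) (hY : CMDiffAt ∞ (T% Y) x)
    (hZ : CMDiffAt ∞ (T% Z) x) : CMDiffAt ∞ (koszul X Y Z) x := by
  have hderiv {U V W : Π x : M, TangentSpace I x} (hU : CMDiffAt ∞ (T% U) x)
      (hV : CMDiffAt ∞ (T% V) x) (hW : CMDiffAt ∞ (T% W) x) :
      CMDiffAt ∞ (fun y ↦ d% (fun z ↦ ⟪V z, W z⟫) y (U y)) x :=
    contMDiffAt_mvfderiv_apply (contMDiffAt_inner hV hW) hU (by simp)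
  have hbracket {U V W : Π x : M, TangentSpace I x} (hU : CMDiffAt ∞ (T% U) x)
      (hV : CMDiffAt ∞ (T% V) x) (hW : CMDiffAt ∞ (T% W) x) :
      CMDiffAt ∞ (fun y ↦ ⟪mlieBracket I U V y, W y⟫) x :=
    contMDiffAt_inner (contMDiffAt_mlieBracket hU hV) hW
  exact (((((hderiv hX hY hZ).add (hderiv hY hX hZ)).sub (hderiv hZ hX hY)).add
    (hbracket hX hY hZ)).sub (hbracket hX hZ hY)).sub (hbracket hY hZ hX)

theorem contMDiffAt_inner_leviCivita (hX : CMDiffAt ∞ (T% X) x) (hY : CMDiffAt ∞ (T% Y) x)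
    (hZ : CMDiffAt ∞ (T% Z) x) : CMDiffAt ∞ (fun y ↦ ⟪leviCivita I M Y y (X y), Z y⟫) x := by
  refine ((contMDiffAt_koszul hX hY hZ).div_const 2).congr_of_eventuallyEq ?_
  filter_upwards [eventually_mdifferentiableAt_section hX (by simp),
    eventually_mdifferentiableAt_section hY (by simp),
    eventually_mdifferentiableAt_section hZ (by simp)] with y hX hY hZ
  exact inner_leviCivita hX hY hZ

omit [CompleteSpace E] in
theorem contMDiffCovariantDerivative_of_inner
    (h : ∀ (x : M) (X Y Z : Π x : M, TangentSpace I x), CMDiffAt ∞ (T% X) x →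
      CMDiffAt ∞ (T% Y) x → CMDiffAt ∞ (T% Z) x →
      CMDiffAt ∞ (fun y ↦ ⟪D Y y (X y), Z y⟫) x) :
    CovariantDerivative.ContMDiffCovariantDerivative D ∞ := by
  refine ⟨⟨fun {Y} hY x _ ↦ ContMDiffAt.contMDiffWithinAt ?_⟩⟩
  have hYx : CMDiffAt ∞ (T% Y) x := (hY.contMDiffAt Filter.univ_mem).of_le le_self_add
  exact contMDiffAt_hom_of_apply fun X hX ↦
    contMDiffAt_of_inner (V := fun x : M ↦ TangentSpace I x) fun Z hZ ↦ h x X Y Z hX hYx hZ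

theorem extDerivOne_innerSL {ξ : Π x : M, TangentSpace I x} (hξ : MDiffAt (T% ξ) x)
    (hX : MDiffAt (T% X) x) (hY : MDiffAt (T% Y) x) :
    extDerivOne (fun y ↦ innerSL ℝ (ξ y)) X Y x
      = ⟪leviCivita I M ξ x (X x), Y x⟫ - ⟪leviCivita I M ξ x (Y x), X x⟫ := by
  simp only [extDerivOne, innerSL_apply_apply]
  rw [leviCivita_preservesMetric x X ξ Y hX hξ hY, leviCivita_preservesMetric x Y ξ X hY hξ hX,
    mlieBracket_eq_covDeriv_sub leviCivita_torsion hX hY, inner_sub_right]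
  ring

theorem extDerivTwo_innerSL_comp {Φ : Π x : M, TangentSpace I x →L[ℝ] TangentSpace I x}
    (hΦ : MDifferentiableAt I (I.prod 𝓘(ℝ, E →L[ℝ] E)) (fun y ↦ TotalSpace.mk' (E →L[ℝ] E)
      (E := fun y : M ↦ TangentSpace I y →L[ℝ] TangentSpace I y) y (Φ y)) x)
    (hskew : ∀ u v, ⟪Φ x u, v⟫ = -⟪u, Φ x v⟫)
    (hX : MDiffAt (T% X) x) (hY : MDiffAt (T% Y) x) (hZ : MDiffAt (T% Z) x) :
    extDerivTwo (fun y ↦ innerSL ℝ ∘L Φ y) X Y Z x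
      = ⟪covDerivEnd (leviCivita I M) hΦ (Y x) (X x), Z x⟫
        + ⟪covDerivEnd (leviCivita I M) hΦ (Z x) (Y x), X x⟫
        + ⟪covDerivEnd (leviCivita I M) hΦ (X x) (Z x), Y x⟫ := by
  have hderiv {U V W : Π x : M, TangentSpace I x} (hU : MDiffAt (T% U) x)
      (hV : MDiffAt (T% V) x) (hW : MDiffAt (T% W) x) :
      d% (fun y ↦ ⟪Φ y (V y), W y⟫) x (U x) = ⟪covDerivEnd (leviCivita I M) hΦ (V x) (U x), W x⟫
        + ⟪Φ x (leviCivita I M V x (U x)), W x⟫ + ⟪Φ x (V x), leviCivita I M W x (U x)⟫ := by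
    rw [leviCivita_preservesMetric x U _ W hU (hΦ.clm_bundle_apply (b := id) hV) hW,
      covDeriv_clm_apply (leviCivita I M) hΦ hV, inner_add_left]
  have hswap (u v : TangentSpace I x) : ⟪Φ x u, v⟫ = -⟪Φ x v, u⟫ := by
    rw [hskew, real_inner_comm]
  change d% (fun y ↦ ⟪Φ y (Y y), Z y⟫) x (X x) + d% (fun y ↦ ⟪Φ y (Z y), X y⟫) x (Y x)
    + d% (fun y ↦ ⟪Φ y (X y), Y y⟫) x (Z x) - ⟪Φ x (mlieBracket I X Y x), Z x⟫
    - ⟪Φ x (mlieBracket I Y Z x), X x⟫ - ⟪Φ x (mlieBracket I Z X x), Y x⟫ = _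
  rw [hderiv hX hY hZ, hderiv hY hZ hX, hderiv hZ hX hY,
    mlieBracket_eq_covDeriv_sub leviCivita_torsion hX hY,
    mlieBracket_eq_covDeriv_sub leviCivita_torsion hY hZ,
    mlieBracket_eq_covDeriv_sub leviCivita_torsion hZ hX]
  simp only [map_sub, inner_sub_left]
  linear_combination hswap (Y x) (leviCivita I M Z x (X x)) +
    hswap (Z x) (leviCivita I M X x (Y x)) + hswap (X x) (leviCivita I M Y x (Z x))

section SkewPerturbation

variable {c : Π x : M, TangentSpace I x → TangentSpace I x → TangentSpace I x → ℝ}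
  (hDc : ∀ (Y : Π x : M, TangentSpace I x) (x : M) (u w : TangentSpace I x),
    ⟪D Y x u, w⟫ = ⟪leviCivita I M Y x u, w⟫ + c x u (Y x) w / 2)
  (hc : ∀ x u v w, c x u v w = -c x u w v)
include hDc hc

theorem preservesMetric_of_inner_eq : PreservesMetric D := by
  intro x X Y Z hX hY hZ
  rw [leviCivita_preservesMetric x X Y Z hX hY hZ, hDc, real_inner_comm (D Z x (X x)), hDc, hc,
    real_inner_comm (leviCivita I M Z x (X x))]
  ring

theorem inner_torsion_of_inner_eq (hcyc : ∀ x u v w, c x u v w = c x v w u)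
    (u v w : TangentSpace I x) : ⟪D.torsion x u v, w⟫ = c x u v w := by
  obtain ⟨U, rfl, hU⟩ := exists_mdifferentiableAt_section I E u
  obtain ⟨V, rfl, hV⟩ := exists_mdifferentiableAt_section I E v
  rw [D.torsion_apply hU hV, mlieBracket_eq_covDeriv_sub leviCivita_torsion hU hV]
  simp only [inner_sub_left, hDc]
  rw [hcyc x (V x), hc x (U x) w]
  ring

theorem hasSkewTorsion_of_inner_eq (hcyc : ∀ x u v w, c x u v w = c x v w u) :
    HasSkewTorsion D := by
  intro x u v w
  rw [inner_torsion_of_inner_eq hDc hc hcyc, inner_torsion_of_inner_eq hDc hc hcyc, hc]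

end SkewPerturbation

end RiemannianManifold

namespace AlmostContactMetric

variable {E : Type*} [NormedAddCommGroup E] [NormedSpace ℝ E]
  {H : Type*} [TopologicalSpace H] {I : ModelWithCorners ℝ E H}
  {M : Type*} [TopologicalSpace M] [ChartedSpace H M] [IsManifold I ∞ M]
  [RiemannianBundle (fun x : M ↦ TangentSpace I x)]
  (S : AlmostContactMetric I M) {x : M} {X Y Z : Π x : M, TangentSpace I x}

theorem mdifferentiableAt_ξ (x : M) : MDiffAt (T% S.ξ) x :=
  S.contMDiff_ξ.contMDiffAt.mdifferentiableAt (by simp)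

theorem mdifferentiableAt_φ (x : M) : MDifferentiableAt I (I.prod 𝓘(ℝ, E →L[ℝ] E))
    (fun y ↦ TotalSpace.mk' (E →L[ℝ] E)
      (E := fun y : M ↦ TangentSpace I y →L[ℝ] TangentSpace I y) y (S.φ y)) x :=
  S.contMDiff_φ.contMDiffAt.mdifferentiableAt (by simp)

theorem φField_φField (X : Π x : M, TangentSpace I x) :
    S.φField (S.φField X) = (-1 : ℝ) • X + (fun y ↦ ⟪S.ξ y, X y⟫) • S.ξ := by
  ext y
  rw [neg_one_smul]
  exact S.φ_φ y (X y)

theorem contMDiffAt_φField (hX : CMDiffAt ∞ (T% X) x) : CMDiffAt ∞ (T% (S.φField X)) x :=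
  ContMDiffAt.clm_bundle_apply (b := id) (E₁ := fun x : M ↦ TangentSpace I x)
    (E₂ := fun x : M ↦ TangentSpace I x) S.contMDiff_φ.contMDiffAt hX

variable [IsContMDiffRiemannianBundle I ∞ E (fun x : M ↦ TangentSpace I x)]

theorem contMDiffAt_η (hX : CMDiffAt ∞ (T% X) x) : CMDiffAt ∞ (fun y ↦ S.η y (X y)) x :=
  contMDiffAt_inner S.contMDiff_ξ.contMDiffAt hX

theorem contMDiffAt_F (hX : CMDiffAt ∞ (T% X) x) (hY : CMDiffAt ∞ (T% Y) x) :
    CMDiffAt ∞ (fun y ↦ S.F y (X y) (Y y)) x :=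
  contMDiffAt_inner (S.contMDiffAt_φField hX) hY

variable [FiniteDimensional ℝ E] [CompleteSpace E]

theorem φ_skew (x : M) (u v : TangentSpace I x) : ⟪S.φ x u, v⟫ = -⟪u, S.φ x v⟫ := by
  rw [real_inner_comm _ u]
  exact S.F_swap x u v

/-- The covariant derivative of `φ` for the Levi-Civita connection `∇`, with the direction of
differentiation first: `S.nablaφ x u v = (∇_u φ) v`. -/
def nablaφ (x : M) : TangentSpace I x →L[ℝ] TangentSpace I x →L[ℝ] TangentSpace I x :=
  (covDerivEnd (leviCivita I M) (S.mdifferentiableAt_φ x)).flip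

theorem leviCivita_φField (hY : MDiffAt (T% Y) x) (u : TangentSpace I x) :
    leviCivita I M (S.φField Y) x u = S.nablaφ x u (Y x) + S.φ x (leviCivita I M Y x u) :=
  covDeriv_clm_apply _ (S.mdifferentiableAt_φ x) hY u

theorem nablaφ_apply (x : M) (u v : TangentSpace I x) :
    S.nablaφ x u v = covDerivEnd (leviCivita I M) (S.mdifferentiableAt_φ x) v u :=
  rfl

theorem nablaφ_skew (x : M) (u v w : TangentSpace I x) :
    ⟪S.nablaφ x u v, w⟫ = -⟪v, S.nablaφ x u w⟫ := by
  rw [nablaφ_apply, nablaφ_apply]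
  exact inner_covDerivEnd_of_skew leviCivita_preservesMetric (S.mdifferentiableAt_φ x) S.φ_skew
    u v w

theorem nablaφ_φ (x : M) (u v : TangentSpace I x) :
    S.nablaφ x u (S.φ x v) = -S.φ x (S.nablaφ x u v)
      + ⟪leviCivita I M S.ξ x u, v⟫ • S.ξ x + ⟪S.ξ x, v⟫ • leviCivita I M S.ξ x u := by
  obtain ⟨U, rfl, hU⟩ := exists_mdifferentiableAt_section I E u
  obtain ⟨V, rfl, hV⟩ := exists_mdifferentiableAt_section I E v
  have hξ := S.mdifferentiableAt_ξ x
  have hηV := mdifferentiableAt_inner hξ hV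
  have hnegV : MDiffAt (T% ((-1 : ℝ) • V)) x := mdifferentiableAt_const.smul_section hV
  have hleibniz := (leviCivita I M).isCovariantDerivativeOnUniv
  have hφφ := S.leviCivita_φField (S.mdifferentiableAt_φField hV) (U x)
  rw [S.leviCivita_φField hV, S.φField_φField,
    hleibniz.add hnegV (hηV.smul_section hξ),
    hleibniz.leibniz hξ hηV, hleibniz.smul_const _ hV] at hφφ
  simp only [_root_.add_apply, _root_.smul_apply, ContinuousLinearMap.smulRight_apply,
    leviCivita_preservesMetric x U S.ξ V hU hξ hV, map_add, S.φ_φ, φField] at hφφ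
  linear_combination (norm := module) -hφφ

theorem sasakiHatakeyama_eq (hX : MDiffAt (T% X) x) (hY : MDiffAt (T% Y) x) :
    S.sasakiHatakeyama X Y x = S.nablaφ x (S.φ x (X x)) (Y x) - S.nablaφ x (S.φ x (Y x)) (X x)
      - S.φ x (S.nablaφ x (X x) (Y x)) + S.φ x (S.nablaφ x (Y x) (X x))
      + (⟪leviCivita I M S.ξ x (X x), Y x⟫ - ⟪leviCivita I M S.ξ x (Y x), X x⟫) • S.ξ x := by
  have hnijenhuis :=
    nijenhuis_eq_covDerivEnd leviCivita_torsion (S.mdifferentiableAt_φ x) hX hY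
  have hη := extDerivOne_innerSL (S.mdifferentiableAt_ξ x) hX hY
  exact congrArg₂ (· + · • S.ξ x) hnijenhuis hη

theorem torsionForm_eq_contactTorsion (hX : MDiffAt (T% X) x) (hY : MDiffAt (T% Y) x)
    (hZ : MDiffAt (T% Z) x) :
    S.torsionForm X Y Z x =
      contactTorsion (S.ξ x) (S.φ x) (leviCivita I M S.ξ x) (S.nablaφ x) (X x) (Y x) (Z x) := by
  have hη {X Y : Π x : M, TangentSpace I x} (hX : MDiffAt (T% X) x) (hY : MDiffAt (T% Y) x) :
      extDerivOne S.η X Y x =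
        ⟪leviCivita I M S.ξ x (X x), Y x⟫ - ⟪leviCivita I M S.ξ x (Y x), X x⟫ :=
    extDerivOne_innerSL (S.mdifferentiableAt_ξ x) hX hY
  have hF := extDerivTwo_innerSL_comp (S.mdifferentiableAt_φ x) (S.φ_skew x)
    (S.mdifferentiableAt_φField hX) (S.mdifferentiableAt_φField hY) (S.mdifferentiableAt_φField hZ)
  rw [torsionForm, hη hX hY, hη hY hZ, hη hZ hX]
  exact congrArg (_ + ·) hF

theorem torsionTensor_eq_contactTorsion (u v w : TangentSpace I x) :
    S.torsionTensor x u v w =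
      contactTorsion (S.ξ x) (S.φ x) (leviCivita I M S.ξ x) (S.nablaφ x) u v w := by
  obtain ⟨U, rfl, hU⟩ := exists_mdifferentiableAt_section I E u
  obtain ⟨V, rfl, hV⟩ := exists_mdifferentiableAt_section I E v
  obtain ⟨W, rfl, hW⟩ := exists_mdifferentiableAt_section I E w
  rw [S.torsionTensor_apply hU hV hW, S.torsionForm_eq_contactTorsion hU hV hW]

theorem torsionTensor_cyclic (u v w : TangentSpace I x) :
    S.torsionTensor x u v w = S.torsionTensor x v w u := by
  simp only [torsionTensor_eq_contactTorsion]
  exact contactTorsion_cyclic _ _ _ _ u v w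

theorem torsionTensor_swap_right (u v w : TangentSpace I x) :
    S.torsionTensor x u v w = -S.torsionTensor x u w v := by
  simp only [torsionTensor_eq_contactTorsion]
  exact contactTorsion_swap_right (S.nablaφ_skew x) u v w

theorem inner_torsionConnection_apply (Y : Π x : M, TangentSpace I x) (x : M)
    (u w : TangentSpace I x) : ⟪S.torsionConnection Y x u, w⟫ =
      ⟪leviCivita I M Y x u, w⟫ + S.torsionTensor x u (Y x) w / 2 := by
  simp [torsionConnection, CovariantDerivative.addOneForm, inner_add_left, real_inner_smul_left,
    inner_sharp, div_eq_inv_mul]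

theorem torsionConnection_preservesMetric : PreservesMetric S.torsionConnection :=
  preservesMetric_of_inner_eq S.inner_torsionConnection_apply
    fun _ ↦ S.torsionTensor_swap_right

theorem torsionConnection_hasSkewTorsion : HasSkewTorsion S.torsionConnection :=
  hasSkewTorsion_of_inner_eq S.inner_torsionConnection_apply
    (fun _ ↦ S.torsionTensor_swap_right) fun _ ↦ S.torsionTensor_cyclic

omit [FiniteDimensional ℝ E] in
theorem contMDiffAt_torsionForm (hX : CMDiffAt ∞ (T% X) x) (hY : CMDiffAt ∞ (T% Y) x)
    (hZ : CMDiffAt ∞ (T% Z) x) : CMDiffAt ∞ (S.torsionForm X Y Z) x := by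
  have hη {U V W : Π x : M, TangentSpace I x} (hU : CMDiffAt ∞ (T% U) x)
      (hV : CMDiffAt ∞ (T% V) x) (hW : CMDiffAt ∞ (T% W) x) :
      CMDiffAt ∞ (fun y ↦ S.η y (U y) * extDerivOne S.η V W y) x :=
    (S.contMDiffAt_η hU).mul (contMDiffAt_extDerivOne (fun _ ↦ S.contMDiffAt_η) hV hW)
  exact (((hη hX hY hZ).add (hη hY hZ hX)).add (hη hZ hX hY)).add
    (contMDiffAt_extDerivTwo (fun _ _ ↦ S.contMDiffAt_F) (S.contMDiffAt_φField hX)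
      (S.contMDiffAt_φField hY) (S.contMDiffAt_φField hZ))

theorem contMDiffAt_torsionTensor (hX : CMDiffAt ∞ (T% X) x) (hY : CMDiffAt ∞ (T% Y) x)
    (hZ : CMDiffAt ∞ (T% Z) x) :
    CMDiffAt ∞ (fun y ↦ S.torsionTensor y (X y) (Y y) (Z y)) x := by
  refine (S.contMDiffAt_torsionForm hX hY hZ).congr_of_eventuallyEq ?_
  filter_upwards [eventually_mdifferentiableAt_section hX (by simp),
    eventually_mdifferentiableAt_section hY (by simp),
    eventually_mdifferentiableAt_section hZ (by simp)] with y hX hY hZ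
  exact S.torsionTensor_apply hX hY hZ

theorem contMDiffCovariantDerivative_torsionConnection :
    CovariantDerivative.ContMDiffCovariantDerivative S.torsionConnection ∞ :=
  contMDiffCovariantDerivative_of_inner fun x X Y Z hX hY hZ ↦ by
    simp only [inner_torsionConnection_apply]
    exact (contMDiffAt_inner_leviCivita hX hY hZ).add
      ((S.contMDiffAt_torsionTensor hX hY hZ).div_const 2)

theorem isKillingReeb_iff : S.IsKillingReeb ↔ ∀ (x : M) (u v : TangentSpace I x),
    ⟪leviCivita I M S.ξ x u, v⟫ = -⟪u, leviCivita I M S.ξ x v⟫ := by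
  have hlie {x : M} {X Y : Π y : M, TangentSpace I y} (hX : MDiffAt (T% X) x)
      (hY : MDiffAt (T% Y) x) : lieDerivMetric S.ξ X Y x =
        ⟪leviCivita I M S.ξ x (X x), Y x⟫ + ⟪X x, leviCivita I M S.ξ x (Y x)⟫ := by
    rw [lieDerivMetric_eq_covDeriv_add_torsion leviCivita_preservesMetric
      (S.mdifferentiableAt_ξ x) hX hY, leviCivita_torsion]
    simp only [Pi.zero_apply, _root_.zero_apply, add_zero]
  refine ⟨fun h x u v ↦ ?_, fun h x X Y hX hY ↦ ?_⟩
  · obtain ⟨U, rfl, hU⟩ := exists_mdifferentiableAt_section I E u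
    obtain ⟨V, rfl, hV⟩ := exists_mdifferentiableAt_section I E v
    exact eq_neg_of_add_eq_zero_left ((hlie hU hV).symm.trans (h x U V hU hV))
  · exact (hlie hX hY).trans (by rw [h, neg_add_cancel])

variable {S}

theorem IsST.isNormalKillingAt (h : S.IsST) (x : M) :
    IsNormalKillingAt (S.ξ x) (S.φ x) (leviCivita I M S.ξ x) (S.nablaφ x) where
  inner_ξ := by rw [real_inner_self_eq_norm_sq, S.norm_ξ, one_pow]
  φ_ξ := S.φ_ξ x
  φ_φ := S.φ_φ x
  φ_skew := S.φ_skew x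
  A_skew := S.nablaφ_skew x
  A_φ := S.nablaφ_φ x
  B_skew := S.isKillingReeb_iff.1 h.2 x
  normal u v := by
    obtain ⟨U, rfl, hU⟩ := exists_mdifferentiableAt_section I E u
    obtain ⟨V, rfl, hV⟩ := exists_mdifferentiableAt_section I E v
    rw [← S.sasakiHatakeyama_eq hU hV, h.1 x U V hU hV]

theorem IsST.torsionConnection_ξ (h : S.IsST) (x : M) : S.torsionConnection S.ξ x = 0 := by
  ext u
  refine ext_inner_right ℝ fun w ↦ ?_
  rw [inner_torsionConnection_apply, torsionTensor_eq_contactTorsion,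
    (h.isNormalKillingAt x).contactTorsion_ξ, _root_.zero_apply, inner_zero_left]
  ring

theorem IsST.torsionConnection_φField (h : S.IsST) (hY : MDiffAt (T% Y) x)
    (u : TangentSpace I x) :
    S.torsionConnection (S.φField Y) x u = S.φ x (S.torsionConnection Y x u) := by
  refine ext_inner_right ℝ fun w ↦ ?_
  rw [S.φ_skew, inner_torsionConnection_apply, inner_torsionConnection_apply,
    S.leviCivita_φField hY, inner_add_left, S.φ_skew, φField, torsionTensor_eq_contactTorsion,
    torsionTensor_eq_contactTorsion]
  linear_combination (h.isNormalKillingAt x).two_mul_inner_A_add_contactTorsion u (Y x) w / 2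

theorem IsST.isAlmostContactMetricConnection (h : S.IsST) :
    S.IsAlmostContactMetricConnection S.torsionConnection where
  smooth := S.contMDiffCovariantDerivative_torsionConnection
  metric := S.torsionConnection_preservesMetric
  reeb := h.torsionConnection_ξ
  endo _ _ hY u := h.torsionConnection_φField hY u

omit [IsContMDiffRiemannianBundle I ∞ E (fun x : M ↦ TangentSpace I x)] in
theorem IsAlmostContactMetricConnection.isKillingReeb
    {D : CovariantDerivative I E (fun x : M ↦ TangentSpace I x)}
    (hD : S.IsAlmostContactMetricConnection D) (hT : HasSkewTorsion D) : S.IsKillingReeb :=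
  fun x _ _ hX hY ↦
    lieDerivMetric_eq_zero_of_parallel hD.metric hT (S.mdifferentiableAt_ξ x) (hD.reeb x) hX hY

end AlmostContactMetric

end

end SasakiTorsion

theorem mainTheorem5_general
    {E : Type*} [NormedAddCommGroup E] [NormedSpace ℝ E] [FiniteDimensional ℝ E] [CompleteSpace E]
    {H : Type*} [TopologicalSpace H] {I : ModelWithCorners ℝ E H}
    {M : Type*} [TopologicalSpace M] [ChartedSpace H M] [IsManifold I ∞ M]
    [RiemannianBundle (fun x : M ↦ TangentSpace I x)]
    [IsContMDiffRiemannianBundle I ∞ E (fun x : M ↦ TangentSpace I x)]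
    (S : SasakiTorsion.AlmostContactMetric I M) (hS : S.IsNormal) :
    (S.IsST ↔ S.IsAlmostContactMetricConnection S.torsionConnection) ∧
    (S.IsST ↔ ∃ D : CovariantDerivative I E (fun x : M ↦ TangentSpace I x),
      S.IsAlmostContactMetricConnection D ∧ SasakiTorsion.HasSkewTorsion D) := by
  have hskew := S.torsionConnection_hasSkewTorsion
  refine ⟨⟨fun h ↦ h.isAlmostContactMetricConnection, fun h ↦ ⟨hS, h.isKillingReeb hskew⟩⟩,
    ⟨fun h ↦ ⟨_, h.isAlmostContactMetricConnection, hskew⟩, ?_⟩⟩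
  rintro ⟨D, hD, hT⟩
  exact ⟨hS, hD.isKillingReeb hT⟩

theorem mainTheorem5 {n : ℕ} {N : Type*} [TopologicalSpace N]
    [ChartedSpace (EuclideanSpace ℝ (Fin n)) N] [IsManifold (𝓡 n) ∞ N]
    [RiemannianBundle (fun x : N ↦ TangentSpace (𝓡 n) x)]
    [IsContMDiffRiemannianBundle (𝓡 n) ∞ (EuclideanSpace ℝ (Fin n))
      (fun x : N ↦ TangentSpace (𝓡 n) x)]
    (S : SasakiTorsion.AlmostContactMetric (𝓡 n) N) (hS : S.IsNormal) :
    (S.IsST ↔ S.IsAlmostContactMetricConnection S.torsionConnection) ∧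
    (S.IsST ↔ ∃ D : CovariantDerivative (𝓡 n) (EuclideanSpace ℝ (Fin n))
        (fun x : N ↦ TangentSpace (𝓡 n) x),
      S.IsAlmostContactMetricConnection D ∧ SasakiTorsion.HasSkewTorsion D) :=
  mainTheorem5_general S hS
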